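/- Let $n\ge 1$ be an integer, let $\mathcal{M}_n$ be the algebra of $n\times n$ complex matrices and let $\langle\cdot,\cdot\rangle$ be the standard inner product on $\mathbb{C}^n$. For $A\in\mathcal{M}_n$ let $W(A)=\{\langle Ax,x\rangle : x\in\mathbb{C}^n,\ \|x\|=1\}$ and $w(A)=\sup\{|\langle Ax,x\rangle| : x\in\mathbb{C}^n,\ \|x\|=1\}$ be the numerical range and the numerical radius of $A$. For $\gamma\in[0,\pi/2)$ write $A\in\Pi_\gamma$ if $W(A)\subseteq\{z\in\mathbb{C} : \Re z>0,\ |\Im z|\le(\tan\gamma)\,\Re z\}$. For $A\in\Pi_\gamma$ and $t\in(0,1)$ let $$A^t=\frac{1}{2\pi i}\int_\Gamma z^t(zI-A)^{-1}\,dz,$$ where $z^t$ is the principal branch and $\Gamma$ is a positively oriented simple closed smooth curve in $\mathbb{C}\setminus(-\infty,0]$ (for instance a circle) enclosing all eigenvalues of $A$; the value does not depend on $\Gamma$. Let $\gamma\in[0,\pi/2)$ and $A,B\in\Pi_\gamma$. Then for all $\alpha\in(0,1)$, $$w(A+B)\le\sqrt{1+2\sin^2(\alpha\gamma)}\,\sqrt{1+2\sin^2((1-\alpha)\gamma)}\,\bigl(w(A^\alpha)+w(B^\alpha)\bigr)\bigl(w(A^{1-\alpha})+w(B^{1-\alpha})\bigr)$$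 and $$w(A+B)\le\Bigl(\sqrt{1+2\sin^2(\alpha\gamma)}\,w(A^\alpha)+\sqrt{1+2\sin^2((1-\alpha)\gamma)}\,w(B^{1-\alpha})\Bigr)\Bigl(\sqrt{1+2\sin^2((1-\alpha)\gamma)}\,w(A^{1-\alpha})+\sqrt{1+2\sin^2(\alpha\gamma)}\,w(B^{\alpha})\Bigr).$$ -/

import Mathlib

namespace SectorialMatrix

/-- The numerical range `W(A) = {⟨Ax, x⟩ : x ∈ ℂⁿ, ‖x‖ = 1}` with the Euclidean norm. Mathlib's
inner product is linear in the second variable, so `⟨Ax, x⟩` is `inner ℂ x (A x)`. -/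
def numericalRange {n : ℕ} (A : Matrix (Fin n) (Fin n) ℂ) : Set ℂ :=
  {w | ∃ x : EuclideanSpace ℂ (Fin n), ‖x‖ = 1 ∧ w = inner ℂ x (Matrix.toEuclideanLin A x)}

/-- The numerical radius `w(A) = sup {|⟨Ax, x⟩| : x ∈ ℂⁿ, ‖x‖ = 1}`. -/
noncomputable def numericalRadius {n : ℕ} (A : Matrix (Fin n) (Fin n) ℂ) : ℝ :=
  sSup ((fun w : ℂ => ‖w‖) '' numericalRange A)

/-- The sector `S_γ = {z : Re z > 0, |Im z| ≤ (tan γ) Re z}`. -/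
def sector (γ : ℝ) : Set ℂ :=
  {z | 0 < z.re ∧ |z.im| ≤ Real.tan γ * z.re}

/-- The class `Π_γ` of sectorial matrices: `W(A) ⊆ S_γ`. -/
def sectorialClass (n : ℕ) (γ : ℝ) : Set (Matrix (Fin n) (Fin n) ℂ) :=
  {A | numericalRange A ⊆ sector γ}

/-- The circle with centre `c` and radius `r` is an admissible integration contour for the
fractional powers of `A`: the circle and its interior lie in `ℂ \ (-∞, 0]`, the domain of the
principal branch of `z ↦ z ^ t`, and all eigenvalues of `A` lie in its interior. -/
def IsContour {n : ℕ} (A : Matrix (Fin n) (Fin n) ℂ) (c : ℂ) (r : ℝ) : Prop :=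
  0 < r ∧ Metric.closedBall c r ⊆ Complex.slitPlane ∧ spectrum ℂ A ⊆ Metric.ball c r

/-- The Dunford-Taylor integral `(2πi)⁻¹ ∮_{|z - c| = r} z ^ t (zI - A)⁻¹ dz`, taken entrywise,
over the positively oriented circle, with the principal branch of `z ^ t`. -/
noncomputable def dunfordPow {n : ℕ} (A : Matrix (Fin n) (Fin n) ℂ) (t : ℝ) (c : ℂ) (r : ℝ) :
    Matrix (Fin n) (Fin n) ℂ :=
  Matrix.of fun i j => (2 * (Real.pi : ℂ) * Complex.I)⁻¹ *
    ∮ z in C(c, r), z ^ (t : ℂ) * (z • (1 : Matrix (Fin n) (Fin n) ℂ) - A)⁻¹ i j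

open Classical in
/-- The fractional power `A ^ t` as a Dunford-Taylor integral over an admissible circle. By
Cauchy's theorem the value does not depend on the contour. Every matrix whose spectrum lies in the
open right half-plane, in particular every accretive and every sectorial matrix, has such a circle
(`exists_isContour`); for a matrix without one the value is the placeholder `0`. -/
noncomputable def fracPow {n : ℕ} (A : Matrix (Fin n) (Fin n) ℂ) (t : ℝ) :
    Matrix (Fin n) (Fin n) ℂ :=
  if h : ∃ p : ℂ × ℝ, IsContour A p.1 p.2 then dunfordPow A t h.choose.1 h.choose.2 else 0

theorem spectrum_re_pos {n : ℕ} {γ : ℝ} {A : Matrix (Fin n) (Fin n) ℂ}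
    (hA : A ∈ sectorialClass n γ) {l : ℂ} (hl : l ∈ spectrum ℂ A) : 0 < l.re := by
  rw [← Matrix.spectrum_toLpLin 2, ← Module.End.hasEigenvalue_iff_mem_spectrum] at hl
  obtain ⟨v, hv⟩ := hl.exists_hasEigenvector
  have hv0 : (‖v‖ : ℂ) ≠ 0 := by simpa using hv.2
  have hmem : l ∈ numericalRange A := by
    refine ⟨((‖v‖ : ℂ)⁻¹) • v, ?_, ?_⟩
    · simp [norm_smul, hv.2]
    · rw [map_smul, hv.apply_eq_smul, inner_smul_left, inner_smul_right, inner_smul_right,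
        inner_self_eq_norm_sq_to_K]
      simp only [map_inv₀, Complex.conj_ofReal, Complex.coe_algebraMap]
      field_simp
  exact (hA hmem).1

/-- Sectorial matrices have admissible circles. -/
theorem exists_isContour {n : ℕ} {γ : ℝ} {A : Matrix (Fin n) (Fin n) ℂ}
    (hA : A ∈ sectorialClass n γ) : ∃ p : ℂ × ℝ, IsContour A p.1 p.2 := by
  have hfin : (spectrum ℂ A).Finite := Matrix.finite_spectrum A
  obtain ⟨m, hm, hmle⟩ : ∃ m : ℝ, 0 < m ∧ ∀ l ∈ spectrum ℂ A, m ≤ l.re := by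
    rcases (spectrum ℂ A).eq_empty_or_nonempty with h | h
    · exact ⟨1, one_pos, by simp [h]⟩
    · obtain ⟨l, hl, hmin⟩ := Set.exists_min_image _ Complex.re hfin h
      exact ⟨l.re, spectrum_re_pos hA hl, hmin⟩
  obtain ⟨M, hM⟩ := hfin.isBounded.exists_norm_le
  obtain ⟨R, hR1, hR2⟩ : ∃ R : ℝ, m < R ∧ M ^ 2 < R * m :=
    ⟨max m (M ^ 2 / m) + 1, by linarith [le_max_left m (M ^ 2 / m)], by
      rw [← div_lt_iff₀ hm]; linarith [le_max_right m (M ^ 2 / m)]⟩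
  refine ⟨((R : ℂ), R - m / 2), by dsimp only; linarith, ?_, ?_⟩
  · intro z hz
    rw [Metric.mem_closedBall, dist_eq_norm] at hz
    have h1 := (Complex.abs_re_le_norm (z - R)).trans hz
    rw [Complex.sub_re, Complex.ofReal_re, abs_le] at h1
    left
    linarith
  · intro l hl
    rw [Metric.mem_ball, dist_eq_norm]
    refine lt_of_pow_lt_pow_left₀ 2 (by linarith) ?_
    have h1 : ‖l‖ ^ 2 ≤ M ^ 2 := pow_le_pow_left₀ (norm_nonneg _) (hM l hl) 2
    have h2 := hmle l hl
    rw [Complex.sq_norm, Complex.normSq_apply] at h1 ⊢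
    simp only [Complex.sub_re, Complex.sub_im, Complex.ofReal_re, Complex.ofReal_im, sub_zero]
    nlinarith

end SectorialMatrix

/-! Both inequalities weaken a single sharper one. Put `p = √(1 + 2 sin²(αγ))` and `q = √(1 + 2
sin²((1-α)γ))`. Since `A = A^α A^(1-α)`, and likewise for `B`, one has `w(A+B) ≤ ‖A‖ + ‖B‖ ≤ ‖A^α‖
‖A^(1-α)‖ + ‖B^α‖ ‖B^(1-α)‖`. The bound `‖A^t‖ ≤ √(1 + 2 sin²(tγ)) w(A^t)` then gives
`numericalRadius_add_le`, and expanding the two stated products only adds nonnegative cross terms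
(`prod_bounds_of_le`).

Three facts carry this. (1) If the numerical range of `T = H + iK` lies in a sector of half-angle
`arcsin s`, then `H ≥ 0`, `‖H‖ ≤ w(T)` and `‖K‖ ≤ s w(T)`, so `‖H + iK‖² ≤ ‖H‖² + 2‖K‖²` yields the
norm bound (`norm_apply_le_of_sectorial`). (2) The Dunford integral is multiplicative and
independent of the circle, because modulo the characteristic polynomial a holomorphic function is a
polynomial (`dunford_eq_aeval`). (3) `W(A^t)` lies in the sector of half-angle `tγ`
(`fracPow_sectorial`), by Balakrishnan's integral taken along the rays of angle `±γ` that bound the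
original sector. -/

namespace SectorialMatrix

/-! ### Operator norm against numerical radius for sectorial operators. -/

section NormBound

variable {E : Type*} [NormedAddCommGroup E] [InnerProductSpace ℂ E]

theorem re_inner_comm (x y : E) : (inner ℂ x y).re = (inner ℂ y x).re := by
  rw [← inner_conj_symm, Complex.conj_re]

/-- A Hermitian form bounded by `k` on the diagonal has operator norm at most `k`. -/
theorem norm_apply_le_of_isSymmetric {K : E →ₗ[ℂ] E} (hK : K.IsSymmetric) {k : ℝ}
    (hb : ∀ x, |(inner ℂ x (K x)).re| ≤ k * ‖x‖ ^ 2) (x : E) :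
    ‖K x‖ ≤ k * ‖x‖ := by
  -- Polarization: the forms at `x + y` and `x - y` differ by `4 Re⟨y, Kx⟩`, and the parallelogram
  -- law adds up the two bounds.
  have key : ∀ x y : E, 4 * (inner ℂ y (K x)).re ≤ k * (2 * ‖x‖ ^ 2 + 2 * ‖y‖ ^ 2) := by
    intro x y
    have h1 := (abs_le.1 (hb (x + y))).2
    have h2 := (abs_le.1 (hb (x - y))).1
    have h3 := parallelogram_law_with_norm ℂ x y
    have h4 : (inner ℂ x (K y)).re = (inner ℂ y (K x)).re := by
      rw [← hK x y, re_inner_comm]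
    simp only [map_add, map_sub, inner_add_left, inner_add_right, inner_sub_left, inner_sub_right,
      Complex.add_re, Complex.sub_re, h4] at h1 h2
    have h5 := congrArg (k * ·) h3
    simp only [mul_add] at h5
    linarith
  rcases (norm_nonneg x).eq_or_lt' with hx | hx
  · rw [norm_eq_zero] at hx; simp [hx]
  rcases (norm_nonneg (K x)).eq_or_lt' with hy | hy
  · have := (abs_nonneg _).trans (hb x)
    rw [hy]
    by_contra! h
    nlinarith
  -- The scaling gives both arguments the same norm `‖x‖ ‖Kx‖`, so nothing is lost in bounding by
  -- the sum of squares.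
  have h := key ((‖K x‖ : ℂ) • x) ((‖x‖ : ℂ) • K x)
  have e : (inner ℂ ((‖x‖ : ℂ) • K x) (K ((‖K x‖ : ℂ) • x))).re = ‖x‖ * ‖K x‖ * ‖K x‖ ^ 2 := by
    rw [map_smul, inner_smul_left, inner_smul_right, inner_self_eq_norm_sq_to_K]
    simp only [Complex.conj_ofReal, Complex.coe_algebraMap]
    norm_cast
    ring
  rw [e] at h
  simp only [norm_smul, Complex.norm_real, norm_norm] at h
  have h' : (‖x‖ * ‖K x‖ ^ 2) * ‖K x‖ ≤ (‖x‖ * ‖K x‖ ^ 2) * (k * ‖x‖) := by nlinarith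
  exact le_of_mul_le_mul_left h' (by positivity)

/-- The positive form evaluated at `u - y` is nonnegative; expand. -/
theorem two_mul_re_inner_le {H : E →ₗ[ℂ] E} (hH : H.IsSymmetric)
    (hpos : ∀ x, 0 ≤ (inner ℂ x (H x)).re) (u y : E) :
    2 * (inner ℂ y (H u)).re ≤ (inner ℂ u (H u)).re + (inner ℂ y (H y)).re := by
  have h1 := hpos (u - y)
  have h4 : (inner ℂ u (H y)).re = (inner ℂ y (H u)).re := by
    rw [← hH u y, re_inner_comm]
  simp only [map_sub, inner_sub_left, inner_sub_right, Complex.sub_re, h4] at h1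
  linarith

/-- The Bhatia-Kittaneh inequality `‖H + iK‖² ≤ ‖H‖² + 2 ‖K‖²` for `H` positive and `K`
self-adjoint. -/
theorem norm_sq_add_I_smul_le {H K : E →ₗ[ℂ] E} (hH : H.IsSymmetric) (hK : K.IsSymmetric)
    (hpos : ∀ x, 0 ≤ (inner ℂ x (H x)).re) {h k : ℝ} (hh : 0 < h)
    (hHh : ∀ x, (inner ℂ x (H x)).re ≤ h * ‖x‖ ^ 2) (hKk : ∀ x, ‖K x‖ ≤ k * ‖x‖) (x : E) :
    ‖H x + Complex.I • K x‖ ^ 2 ≤ (h ^ 2 + 2 * k ^ 2) * ‖x‖ ^ 2 := by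
  set y := H x + Complex.I • K x with hy
  set v := Complex.I • K x with hv
  -- Chosen so that `h y = H u + (h - H) v` with both `H` and `h - H` positive. Pairing with `y` and
  -- applying `two_mul_re_inner_le` to each form, the `y`-terms sum to `h‖y‖²` and are absorbed on
  -- the left, leaving `‖y‖² ≤ ‖u‖² + ‖v‖²`.
  set u := (h : ℂ) • x + v with hu
  set H' : E →ₗ[ℂ] E := (h : ℂ) • LinearMap.id - H with hH'
  have hself : ∀ z : E, (inner ℂ z z : ℂ).re = ‖z‖ ^ 2 := fun z => by
    rw [inner_self_eq_norm_sq_to_K]; norm_cast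
  have hH'e : ∀ z, H' z = (h : ℂ) • z - H z := fun z => by simp [hH']
  have hH's : H'.IsSymmetric := fun a b => by
    rw [hH'e, hH'e, inner_sub_left, inner_sub_right, hH a b, inner_smul_left, inner_smul_right,
      Complex.conj_ofReal]
  have hH're : ∀ z, (inner ℂ z (H' z)).re = h * ‖z‖ ^ 2 - (inner ℂ z (H z)).re := fun z => by
    rw [hH'e, inner_sub_right, inner_smul_right, Complex.sub_re, Complex.re_ofReal_mul, hself]
  have e1 : (h : ℂ) • y = H u + H' v := by
    rw [hH'e, hu, hy, map_add, map_smul]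
    module
  have e2 : h * ‖y‖ ^ 2 = (inner ℂ y (H u)).re + (inner ℂ y (H' v)).re := by
    rw [← Complex.add_re, ← inner_add_right, ← e1, inner_smul_right, Complex.re_ofReal_mul, hself]
  have i1 := two_mul_re_inner_le hH hpos u y
  have i2 := two_mul_re_inner_le hH's (fun z => by rw [hH're]; linarith [hHh z]) v y
  rw [hH're, hH're] at i2
  have i3 := hHh u
  have i4 := hpos v
  have i5 : h * ‖y‖ ^ 2 ≤ h * (‖u‖ ^ 2 + ‖v‖ ^ 2) := by nlinarith
  have i6 := le_of_mul_le_mul_left i5 hh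
  have n1 : ‖v‖ = ‖K x‖ := by simp [hv, norm_smul]
  -- The cross term vanishes because `⟨x, Kx⟩` is real, hence `⟨x, iKx⟩` is purely imaginary.
  have n2 : ‖u‖ ^ 2 = h ^ 2 * ‖x‖ ^ 2 + ‖K x‖ ^ 2 := by
    have hreal : (inner ℂ x (K x)).im = 0 := by
      have := congrArg Complex.im (inner_conj_symm (𝕜 := ℂ) x (K x))
      rw [hK x x] at this
      simp only [Complex.conj_im] at this
      linarith
    rw [hu, @norm_add_sq ℂ, n1, norm_smul, hv, inner_smul_left, inner_smul_right]
    simp [hreal, mul_pow]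
  have n3 : ‖K x‖ ^ 2 ≤ (k * ‖x‖) ^ 2 := pow_le_pow_left₀ (norm_nonneg _) (hKk x) 2
  rw [n2, n1] at i6
  nlinarith

/-- An operator whose numerical range lies in a sector of half-angle `arcsin s` around the positive
half-line has norm at most `√(1 + 2 s²)` times its numerical radius. -/
theorem norm_apply_le_of_sectorial [FiniteDimensional ℂ E] {T : E →ₗ[ℂ] E} {s w : ℝ} (hs : 0 ≤ s)
    (hre : ∀ x, 0 ≤ (inner ℂ x (T x)).re)
    (him : ∀ x, |(inner ℂ x (T x)).im| ≤ s * ‖inner ℂ x (T x)‖)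
    (hw : ∀ x, ‖inner ℂ x (T x)‖ ≤ w * ‖x‖ ^ 2) (hw0 : 0 ≤ w) (x : E) :
    ‖T x‖ ≤ Real.sqrt (1 + 2 * s ^ 2) * w * ‖x‖ := by
  -- The Bhatia-Kittaneh step divides by `w`; when `w = 0` the quadratic form vanishes, which forces
  -- `T = 0` over `ℂ`.
  rcases hw0.eq_or_lt' with hw0 | hw0
  · have : T = 0 := (inner_map_self_eq_zero T).1 fun x => by
      rw [← inner_conj_symm, map_eq_zero]
      simpa [hw0] using hw x
    simp [this, hw0]
  set S := T.adjoint
  have hSd : ∀ a b, inner ℂ a (S b) = inner ℂ (T a) b := fun a b => LinearMap.adjoint_inner_right T a b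
  have hSd' : ∀ a b, inner ℂ (S a) b = inner ℂ a (T b) := fun a b => LinearMap.adjoint_inner_left T b a
  set H : E →ₗ[ℂ] E := (1 / 2 : ℂ) • (T + S) with hH
  set K : E →ₗ[ℂ] E := (-Complex.I / 2 : ℂ) • (T - S) with hK
  have hHs : H.IsSymmetric := fun a b => by
    simp [hH, inner_smul_left, inner_smul_right, inner_add_left, inner_add_right, hSd, hSd',
      map_ofNat, add_comm]
  have hKs : K.IsSymmetric := fun a b => by
    simp only [hK, LinearMap.smul_apply, LinearMap.sub_apply, inner_smul_left, inner_smul_right,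
      inner_sub_left, inner_sub_right, hSd, hSd']
    simp [map_ofNat]
    ring
  have hHre : ∀ z, (inner ℂ z (H z)).re = (inner ℂ z (T z)).re := fun z => by
    have : (inner ℂ (T z) z).re = (inner ℂ z (T z)).re := re_inner_comm _ _
    simp [hH, hSd, Complex.mul_re, this]
    ring
  have hKre : ∀ z, (inner ℂ z (K z)).re = (inner ℂ z (T z)).im := fun z => by
    have : (inner ℂ (T z) z).im = -(inner ℂ z (T z)).im := by
      rw [← inner_conj_symm, Complex.conj_im]
    simp [hK, hSd, Complex.mul_re, this]
    ring
  have hT : T x = H x + Complex.I • K x := by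
    simp only [hH, hK, LinearMap.smul_apply, LinearMap.sub_apply, LinearMap.add_apply, smul_smul]
    have : Complex.I * (-Complex.I / 2) = 1 / 2 := by
      linear_combination (-1 / 2 : ℂ) * Complex.I_mul_I
    rw [this]
    module
  have hb := norm_sq_add_I_smul_le hHs hKs (fun z => by rw [hHre]; exact hre z) hw0
    (fun z => by rw [hHre]; exact (Complex.re_le_norm _).trans (hw z))
    (norm_apply_le_of_isSymmetric hKs (k := s * w) fun z => by
      rw [hKre, mul_assoc]
      exact (him z).trans (mul_le_mul_of_nonneg_left (hw z) hs)) x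
  rw [← hT] at hb
  refine le_of_sq_le_sq ?_ (by positivity)
  rw [mul_pow, mul_pow, Real.sq_sqrt (by positivity)]
  linarith

end NormBound

/-! ### Holomorphic functional calculus of a matrix over circles. -/

section Dunford

open Polynomial Metric Set Filter Topology

variable {n : ℕ} {A : Matrix (Fin n) (Fin n) ℂ} {c : ℂ} {r : ℝ} {f g : ℂ → ℂ} {U : Set ℂ}

/-- The Dunford integral `(2πi)⁻¹ ∮_{|z - c| = r} f(z) (zI - A)⁻¹ dz`. -/
noncomputable def dunford (A : Matrix (Fin n) (Fin n) ℂ) (f : ℂ → ℂ) (c : ℂ) (r : ℝ) :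
    Matrix (Fin n) (Fin n) ℂ :=
  Matrix.of fun i j => (2 * (Real.pi : ℂ) * Complex.I)⁻¹ *
    ∮ z in C(c, r), f z * (z • (1 : Matrix (Fin n) (Fin n) ℂ) - A)⁻¹ i j

theorem dunford_apply (i j : Fin n) : dunford A f c r i j = (2 * (Real.pi : ℂ) * Complex.I)⁻¹ *
    ∮ z in C(c, r), f z * (z • (1 : Matrix (Fin n) (Fin n) ℂ) - A)⁻¹ i j := rfl

theorem isUnit_smul_one_sub {z : ℂ} (hz : z ∉ spectrum ℂ A) :
    IsUnit (z • (1 : Matrix (Fin n) (Fin n) ℂ) - A) := by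
  rw [← Algebra.algebraMap_eq_smul_one]
  exact spectrum.notMem_iff.1 hz

theorem det_smul_one_sub (A : Matrix (Fin n) (Fin n) ℂ) (z : ℂ) :
    (z • (1 : Matrix (Fin n) (Fin n) ℂ) - A).det = A.charpoly.eval z := by
  rw [Matrix.eval_charpoly, Matrix.scalar_apply, Matrix.smul_one_eq_diagonal]

/-- Cramer's rule: each resolvent entry is a polynomial over the characteristic polynomial, which
gives its holomorphy off the spectrum and shows how multiplication by the characteristic polynomial
removes its poles. -/
theorem resolvent_entry (A : Matrix (Fin n) (Fin n) ℂ) (z : ℂ) (i j : Fin n) :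
    (z • (1 : Matrix (Fin n) (Fin n) ℂ) - A)⁻¹ i j =
      (A.charpoly.eval z)⁻¹ * ((Matrix.charmatrix A).adjugate i j).eval z := by
  have h1 : (evalRingHom z).mapMatrix (Matrix.charmatrix A) =
      z • (1 : Matrix (Fin n) (Fin n) ℂ) - A := by
    ext i j
    by_cases h : i = j
    · subst h; simp
    · simp [h]
  have h2 := RingHom.map_adjugate (evalRingHom z) (Matrix.charmatrix A)
  rw [h1] at h2
  rw [Matrix.inv_def, Matrix.smul_apply, det_smul_one_sub, Ring.inverse_eq_inv', ← h2]
  simp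

theorem eval_charpoly_ne_zero {z : ℂ} (hz : z ∉ spectrum ℂ A) : A.charpoly.eval z ≠ 0 := fun h =>
  hz (Matrix.mem_spectrum_iff_isRoot_charpoly.2 h)

theorem differentiableAt_resolvent_entry {z : ℂ} (hz : z ∉ spectrum ℂ A) (i j : Fin n) :
    DifferentiableAt ℂ (fun z => (z • (1 : Matrix (Fin n) (Fin n) ℂ) - A)⁻¹ i j) z := by
  simp only [resolvent_entry]
  exact (A.charpoly.differentiable.differentiableAt.inv (eval_charpoly_ne_zero hz)).mul
    (Polynomial.differentiable _).differentiableAt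

theorem notMem_spectrum_of_mem_sphere (hA : spectrum ℂ A ⊆ ball c r) {z : ℂ}
    (hz : z ∈ sphere c r) : z ∉ spectrum ℂ A := fun h => by
  have := mem_ball.1 (hA h)
  rw [mem_sphere.1 hz] at this
  exact lt_irrefl _ this

theorem continuousOn_resolvent_entry (hA : spectrum ℂ A ⊆ ball c r) (i j : Fin n) :
    ContinuousOn (fun z => (z • (1 : Matrix (Fin n) (Fin n) ℂ) - A)⁻¹ i j) (sphere c r) :=
  fun _ hz => (differentiableAt_resolvent_entry
    (notMem_spectrum_of_mem_sphere hA hz) i j).continuousAt.continuousWithinAt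

theorem circleIntegrable_mul_resolvent (hr : 0 < r) (hA : spectrum ℂ A ⊆ ball c r)
    (hf : ContinuousOn f (sphere c r)) (i j : Fin n) :
    CircleIntegrable (fun z => f z * (z • (1 : Matrix (Fin n) (Fin n) ℂ) - A)⁻¹ i j) c r :=
  (hf.mul (continuousOn_resolvent_entry hA i j)).circleIntegrable hr.le

theorem dunford_congr (hr : 0 < r) (h : EqOn f g (sphere c r)) :
    dunford A f c r = dunford A g c r := by
  ext i j
  rw [dunford_apply, dunford_apply]
  congr 1
  exact circleIntegral.integral_congr hr.le fun z hz => by simp only [h hz]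

theorem dunford_add (hr : 0 < r) (hA : spectrum ℂ A ⊆ ball c r)
    (hf : ContinuousOn f (sphere c r)) (hg : ContinuousOn g (sphere c r)) :
    dunford A (fun z => f z + g z) c r = dunford A f c r + dunford A g c r := by
  ext i j
  rw [Matrix.add_apply, dunford_apply, dunford_apply, dunford_apply, ← mul_add,
    ← circleIntegral.integral_add (circleIntegrable_mul_resolvent hr hA hf i j)
      (circleIntegrable_mul_resolvent hr hA hg i j)]
  simp only [add_mul]

theorem dunford_const_mul (a : ℂ) : dunford A (fun z => a * f z) c r = a • dunford A f c r := by
  ext i j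
  rw [Matrix.smul_apply, dunford_apply, dunford_apply, smul_eq_mul, mul_left_comm,
    ← circleIntegral.integral_const_mul a]
  simp only [mul_assoc]

theorem circleIntegral_eq_zero (hr : 0 < r) (hf : DifferentiableOn ℂ f U) (hU : IsOpen U)
    (hc : closedBall c r ⊆ U) : (∮ z in C(c, r), f z) = 0 :=
  Complex.circleIntegral_eq_zero_of_differentiable_on_off_countable hr.le countable_empty
    (hf.continuousOn.mono hc) fun _ hz =>
      hf.differentiableAt (hU.mem_nhds (hc (ball_subset_closedBall hz.1)))

/-- The factor cancels the denominator in `resolvent_entry`, so the integrand is holomorphic on the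
whole disc and Cauchy's theorem applies. -/
theorem dunford_charpoly_mul (hr : 0 < r) (hA : spectrum ℂ A ⊆ ball c r)
    (hf : DifferentiableOn ℂ f U) (hU : IsOpen U) (hc : closedBall c r ⊆ U) :
    dunford A (fun z => A.charpoly.eval z * f z) c r = 0 := by
  ext i j
  rw [dunford_apply, Matrix.zero_apply, mul_eq_zero]
  right
  rw [circleIntegral.integral_congr hr.le
    (g := fun z => f z * ((Matrix.charmatrix A).adjugate i j).eval z)]
  · exact circleIntegral_eq_zero hr (hf.mul (Polynomial.differentiable _).differentiableOn) hU hc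
  · intro z hz
    have := eval_charpoly_ne_zero (notMem_spectrum_of_mem_sphere hA hz)
    simp only [resolvent_entry]
    field_simp

theorem tendsto_mul_resolvent_entry (A B : Matrix (Fin n) (Fin n) ℂ) (i j : Fin n) :
    Tendsto (fun z : ℂ => (B * (z • (1 : Matrix (Fin n) (Fin n) ℂ) - A)⁻¹) i j)
      (Bornology.cobounded ℂ) (𝓝 0) := by
  -- An auxiliary norm, needed only for the decay of the resolvent at infinity; the conclusion is
  -- entrywise.
  let _ : NormedRing (Matrix (Fin n) (Fin n) ℂ) := Matrix.linftyOpNormedRing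
  let _ : NormedAlgebra ℂ (Matrix (Fin n) (Fin n) ℂ) := Matrix.linftyOpNormedAlgebra
  have h := spectrum.resolvent_tendsto_cobounded (𝕜 := ℂ) A
  have hc : Continuous fun M : Matrix (Fin n) (Fin n) ℂ => (B * M) i j := by fun_prop
  have h2 := (hc.tendsto 0).comp h
  simp only [mul_zero, Matrix.zero_apply] at h2
  refine h2.congr fun z => ?_
  simp only [Function.comp, resolvent, Algebra.algebraMap_eq_smul_one,
    Matrix.nonsing_inv_eq_ringInverse]

/-- Write `(z - A)⁻¹ = (z - c)⁻¹ (1 + (A - c)(z - A)⁻¹)`. The first term contributes the identity;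
the second is pushed to circles of arbitrarily large radius, where the resolvent tends to `0`. -/
theorem dunford_one (hr : 0 < r) (hA : spectrum ℂ A ⊆ ball c r) :
    dunford A (fun _ => 1) c r = 1 := by
  ext i j
  set B := A - c • (1 : Matrix (Fin n) (Fin n) ℂ) with hB
  set g : ℂ → ℂ := fun z => (B * (z • (1 : Matrix (Fin n) (Fin n) ℂ) - A)⁻¹) i j with hg
  have hgd : ∀ z, z ∉ spectrum ℂ A → DifferentiableAt ℂ g z := fun z hz => by
    simp only [hg, Matrix.mul_apply]
    exact DifferentiableAt.fun_sum fun k _ =>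
      (differentiableAt_resolvent_entry hz k j).const_mul _
  have hout : ∀ z, z ∉ ball c r → z ∉ spectrum ℂ A := fun z hz h => hz (hA h)
  have hexp : EqOn (fun z => (1 : ℂ) * (z • (1 : Matrix (Fin n) (Fin n) ℂ) - A)⁻¹ i j)
      (fun z => (1 : Matrix (Fin n) (Fin n) ℂ) i j * (z - c)⁻¹ + (z - c)⁻¹ • g z)
      (sphere c r) := by
    intro z hz
    have hzc : z - c ≠ 0 := by
      rw [sub_ne_zero]; rintro rfl
      simp at hz; linarith
    have hu := (Matrix.isUnit_iff_isUnit_det _).1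
      (isUnit_smul_one_sub (notMem_spectrum_of_mem_sphere hA hz))
    have h1 := Matrix.mul_nonsing_inv _ hu
    have h2 : (z - c) • (z • (1 : Matrix (Fin n) (Fin n) ℂ) - A)⁻¹ =
        1 + B * (z • (1 : Matrix (Fin n) (Fin n) ℂ) - A)⁻¹ := by
      have h4 : (z • (1 : Matrix (Fin n) (Fin n) ℂ) - A) + B = (z - c) • 1 := by
        rw [hB, sub_smul]; abel
      calc _ = ((z - c) • 1) * (z • (1 : Matrix (Fin n) (Fin n) ℂ) - A)⁻¹ := by
            rw [smul_mul_assoc, one_mul]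
        _ = _ := by rw [← h4, add_mul, h1]
    have h3 := congrFun (congrFun h2 i) j
    simp only [Matrix.smul_apply, Matrix.add_apply, smul_eq_mul] at h3
    simp only [hg, smul_eq_mul, one_mul]
    rw [mul_comm _ (z - c)⁻¹, ← mul_add, ← h3, inv_mul_cancel_left₀ hzc]
  have hinvc : ContinuousOn (fun z : ℂ => (z - c)⁻¹) (sphere c r) := by
    refine ContinuousOn.inv₀ (by fun_prop) fun z hz => ?_
    rw [sub_ne_zero]; rintro rfl
    simp at hz; linarith
  have hgc : ContinuousOn g (sphere c r) := fun z hz =>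
    (hgd z (notMem_spectrum_of_mem_sphere hA hz)).continuousAt.continuousWithinAt
  have hzero : (∮ z in C(c, r), (z - c)⁻¹ • g z) = 0 := by
    have hlim := tendsto_mul_resolvent_entry A B i j
    rw [← norm_le_zero_iff]
    refine le_of_forall_pos_le_add fun ε hε => ?_
    have hev := hlim.eventually (Metric.ball_mem_nhds 0 (show 0 < ε / (2 * Real.pi) by positivity))
    rw [Filter.eventually_iff, ← Bornology.isCobounded_def,
      ← Bornology.isBounded_compl_iff] at hev
    obtain ⟨R, hR⟩ := hev.subset_closedBall c
    -- At least `r`, so that the annulus contains no spectrum, and larger than `R`, so that `g` is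
    -- smaller than `ε / (2π)` on the new circle.
    set R' := max r (R + 1)
    have hR' : 0 < R' := lt_max_of_lt_left hr
    rw [← Complex.circleIntegral_sub_center_inv_smul_eq_of_differentiable_on_annulus_off_countable
      hr (le_max_left r (R + 1)) countable_empty
      (fun z hz => (hgd z (hout z hz.2)).continuousAt.continuousWithinAt)
      (fun z hz => hgd z (hout z fun h => hz.1.2 (ball_subset_closedBall h)))]
    refine (circleIntegral.norm_integral_le_of_norm_le_const (C := R'⁻¹ * (ε / (2 * Real.pi)))
      hR'.le fun z hz => ?_).trans (le_of_eq ?_)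
    · have hz1 : ‖z - c‖ = R' := by rw [← dist_eq_norm]; exact mem_sphere.1 hz
      rw [norm_smul, norm_inv, hz1]
      gcongr
      by_contra! hcon
      have hmem : z ∈ closedBall c R := hR (by
        simp only [mem_compl_iff, mem_ofPred_eq, dist_zero_right, not_lt]
        exact hcon.le)
      rw [mem_closedBall, mem_sphere.1 hz] at hmem
      linarith [le_max_right r (R + 1)]
    · field_simp
      simp
  rw [dunford_apply, circleIntegral.integral_congr hr.le hexp,
    circleIntegral.integral_add ((continuousOn_const.fun_mul hinvc).circleIntegrable hr.le)
      ((hinvc.fun_smul hgc).circleIntegrable hr.le), hzero, add_zero,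
    circleIntegral.integral_const_mul, circleIntegral.integral_sub_center_inv _ hr.ne']
  have := Complex.two_pi_I_ne_zero
  field_simp

/-- Since `z (z - A)⁻¹ = 1 + A (z - A)⁻¹`, the difference of the two sides is the integral of the
holomorphic function `f` times the identity, which vanishes. -/
theorem dunford_id_mul (hr : 0 < r) (hA : spectrum ℂ A ⊆ ball c r)
    (hf : DifferentiableOn ℂ f U) (hU : IsOpen U) (hc : closedBall c r ⊆ U) :
    dunford A (fun z => z * f z) c r = A * dunford A f c r := by
  have hfs : ContinuousOn f (sphere c r) :=
    hf.continuousOn.mono (sphere_subset_closedBall.trans hc)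
  ext i j
  have hint : ∀ k, CircleIntegrable
      (fun z => A i k * (f z * (z • (1 : Matrix (Fin n) (Fin n) ℂ) - A)⁻¹ k j)) c r := fun k =>
    (circleIntegrable_mul_resolvent hr hA hfs k j).const_fun_smul
  rw [Matrix.mul_apply]
  simp only [dunford_apply, mul_left_comm (A i _), ← Finset.mul_sum]
  congr 1
  rw [circleIntegral.integral_congr hr.le (g := fun z => (1 : Matrix (Fin n) (Fin n) ℂ) i j * f z +
    ∑ k, A i k * (f z * (z • (1 : Matrix (Fin n) (Fin n) ℂ) - A)⁻¹ k j))]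
  · rw [circleIntegral.integral_add ((continuousOn_const.fun_mul hfs).circleIntegrable hr.le)
      (CircleIntegrable.fun_sum _ fun k _ => hint k),
      circleIntegral.integral_const_mul, circleIntegral_eq_zero hr hf hU hc, mul_zero, zero_add,
      circleIntegral.integral_fun_sum fun k _ => hint k]
    simp only [circleIntegral.integral_const_mul]
  · intro z hz
    have hu := (Matrix.isUnit_iff_isUnit_det _).1
      (isUnit_smul_one_sub (notMem_spectrum_of_mem_sphere hA hz))
    have h1 := Matrix.mul_nonsing_inv _ hu
    rw [sub_mul, smul_mul_assoc, one_mul, sub_eq_iff_eq_add] at h1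
    have h3 := congrFun (congrFun h1 i) j
    simp only [Matrix.smul_apply, Matrix.add_apply, smul_eq_mul, Matrix.mul_apply] at h3
    simp only [mul_left_comm (A i _), ← Finset.mul_sum]
    linear_combination f z * h3

theorem dunford_polynomial_mul (hr : 0 < r) (hA : spectrum ℂ A ⊆ ball c r)
    (hf : DifferentiableOn ℂ f U) (hU : IsOpen U) (hc : closedBall c r ⊆ U) (p : ℂ[X]) :
    dunford A (fun z => p.eval z * f z) c r = aeval A p * dunford A f c r := by
  have hpc : ∀ q : ℂ[X], DifferentiableOn ℂ (fun z => q.eval z * f z) U := fun q =>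
    q.differentiable.differentiableOn.mul hf
  induction p using Polynomial.induction_on with
  | C a => simp [dunford_const_mul, Algebra.algebraMap_eq_smul_one]
  | add p q hp hq =>
    simp only [eval_add, add_mul, map_add]
    rw [← hp, ← hq]
    have hs := sphere_subset_closedBall.trans hc
    exact dunford_add hr hA ((hpc p).continuousOn.mono hs) ((hpc q).continuousOn.mono hs)
  | monomial k a h =>
    have e1 : (fun z => (C a * X ^ (k + 1)).eval z * f z) =
        fun z => z * ((C a * X ^ k).eval z * f z) := by
      ext z; simp; ring
    have e2 : aeval A (C a * X ^ (k + 1)) = A * aeval A (C a * X ^ k) := by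
      rw [pow_succ, ← mul_assoc, mul_comm, map_mul, aeval_X]
    rw [e1, dunford_id_mul hr hA (hpc _) hU hc, h, e2, mul_assoc]

/-- Division with remainder of a holomorphic function by a polynomial with given roots. -/
theorem exists_eq_polynomial_add (hU : IsOpen U) (s : Multiset ℂ) (hs : ∀ l ∈ s, l ∈ U)
    (hf : DifferentiableOn ℂ f U) : ∃ (p : ℂ[X]) (g : ℂ → ℂ), DifferentiableOn ℂ g U ∧
      ∀ z, f z = p.eval z + ((s.map fun a => X - C a).prod).eval z * g z := by
  induction s using Multiset.induction with
  | empty => exact ⟨0, f, hf, by simp⟩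
  | cons l s ih =>
    obtain ⟨p, g, hg, hfg⟩ := ih fun a ha => hs a (Multiset.mem_cons_of_mem ha)
    have hl := hU.mem_nhds (hs l (Multiset.mem_cons_self l s))
    -- One more root is split off by `g z = g l + (z - l) * dslope g l z`; the slope is holomorphic
    -- across `l` by removal of the singularity.
    refine ⟨p + C (g l) * (s.map fun a => X - C a).prod, dslope g l,
      (Complex.differentiableOn_dslope hl).2 hg, fun z => ?_⟩
    have h := sub_smul_dslope g l z
    rw [smul_eq_mul] at h
    rw [hfg z, Multiset.map_cons, Multiset.prod_cons]
    simp only [eval_add, eval_mul, eval_C, eval_sub, eval_X]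
    linear_combination (-((s.map fun a => X - C a).prod).eval z) * h

theorem exists_eq_polynomial_add_charpoly (hA : spectrum ℂ A ⊆ U) (hU : IsOpen U)
    (hf : DifferentiableOn ℂ f U) : ∃ (p : ℂ[X]) (g : ℂ → ℂ), DifferentiableOn ℂ g U ∧
      ∀ z, f z = p.eval z + A.charpoly.eval z * g z := by
  obtain ⟨p, g, hg, h⟩ := exists_eq_polynomial_add hU A.charpoly.roots (fun l hl =>
    hA (Matrix.mem_spectrum_iff_isRoot_charpoly.2 (isRoot_of_mem_roots hl))) hf
  refine ⟨p, g, hg, ?_⟩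
  rwa [← (IsAlgClosed.splits A.charpoly).eq_prod_roots_of_monic A.charpoly_monic] at h

/-- The value `p(A)` does not mention the circle. Independence of the contour and multiplicativity
both reduce to this. -/
theorem dunford_eq_aeval (hr : 0 < r) (hA : spectrum ℂ A ⊆ ball c r) (hU : IsOpen U)
    (hc : closedBall c r ⊆ U) {p : ℂ[X]} (hg : DifferentiableOn ℂ g U)
    (h : ∀ z, f z = p.eval z + A.charpoly.eval z * g z) : dunford A f c r = aeval A p := by
  have hs := sphere_subset_closedBall.trans hc
  have h1 := dunford_polynomial_mul (f := fun _ => 1) hr hA (differentiableOn_const 1) hU hc p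
  rw [dunford_one hr hA, mul_one] at h1
  simp only [mul_one] at h1
  rw [funext h, dunford_add hr hA p.continuous.continuousOn
    (A.charpoly.continuous.continuousOn.fun_mul (hg.continuousOn.mono hs)), h1,
    dunford_charpoly_mul hr hA hg hU hc, add_zero]

/-- The Dunford integral does not depend on the circle. -/
theorem dunford_eq_dunford {c' : ℂ} {r' : ℝ} (hr : 0 < r) (hA : spectrum ℂ A ⊆ ball c r)
    (hr' : 0 < r') (hA' : spectrum ℂ A ⊆ ball c' r') (hf : DifferentiableOn ℂ f U) (hU : IsOpen U)
    (hc : closedBall c r ⊆ U) (hc' : closedBall c' r' ⊆ U) :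
    dunford A f c r = dunford A f c' r' := by
  obtain ⟨p, g, hg, h⟩ := exists_eq_polynomial_add_charpoly
    (hA.trans (ball_subset_closedBall.trans hc)) hU hf
  rw [dunford_eq_aeval hr hA hU hc hg h, dunford_eq_aeval hr' hA' hU hc' hg h]

/-- The Dunford integral is multiplicative. -/
theorem dunford_mul (hr : 0 < r) (hA : spectrum ℂ A ⊆ ball c r) (hf : DifferentiableOn ℂ f U)
    (hg : DifferentiableOn ℂ g U) (hU : IsOpen U) (hc : closedBall c r ⊆ U) :
    dunford A (fun z => f z * g z) c r = dunford A f c r * dunford A g c r := by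
  obtain ⟨p, k, hk, h⟩ := exists_eq_polynomial_add_charpoly
    (hA.trans (ball_subset_closedBall.trans hc)) hU hf
  have hs := sphere_subset_closedBall.trans hc
  rw [dunford_eq_aeval hr hA hU hc hk h, ← dunford_polynomial_mul hr hA hg hU hc p,
    show (fun z => f z * g z) = fun z => p.eval z * g z + A.charpoly.eval z * (k z * g z) by
      ext z; rw [h]; ring,
    dunford_add hr hA (p.continuous.continuousOn.fun_mul (hg.continuousOn.mono hs))
      (A.charpoly.continuous.continuousOn.fun_mul ((hk.fun_mul hg).continuousOn.mono hs)),
    dunford_charpoly_mul hr hA (hk.fun_mul hg) hU hc, add_zero]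

theorem dunford_id (hr : 0 < r) (hA : spectrum ℂ A ⊆ ball c r) :
    dunford A (fun z => z) c r = A := by
  have h := dunford_id_mul (f := fun _ => 1) hr hA (differentiableOn_const 1) isOpen_univ
    (subset_univ _)
  simpa [dunford_one hr hA] using h

end Dunford

/-! ### Balakrishnan's integral for `z ^ t` along an arbitrary ray of the right half-plane. -/

section Balakrishnan

open Set Filter Topology MeasureTheory Metric

variable {t : ℝ} {v : ℂ}

theorem re_smul_add (v z : ℂ) (s : ℝ) : ((s : ℂ) * v + z).re = s * v.re + z.re := by
  simp

theorem smul_add_ne_zero (hv : 0 < v.re) {z : ℂ} (hz : 0 < z.re) {s : ℝ} (hs : 0 ≤ s) :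
    (s : ℂ) * v + z ≠ 0 := fun h => by
  have h1 := re_smul_add v z s
  rw [h, Complex.zero_re] at h1
  have := mul_nonneg hs hv.le
  linarith

theorem le_norm_smul_add {v z : ℂ} {m s : ℝ} (hz : m ≤ z.re) :
    s * v.re + m ≤ ‖(s : ℂ) * v + z‖ := by
  refine le_trans ?_ (Complex.re_le_norm _)
  rw [re_smul_add]
  linarith

/-- The common dominating function of this section: up to the factor `C / m` it is the real
Balakrishnan integrand at the point `m / a`. -/
theorem integrableOn_rpow_div (ht : t ∈ Ioo (0 : ℝ) 1) {a m : ℝ} (ha : 0 < a) (hm : 0 < m)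
    (C : ℝ) : IntegrableOn (fun s : ℝ => s ^ (t - 1) * (C / (s * a + m))) (Ioi 0) := by
  have h := (Real.integrableOn_rpowIntegrand₀₁_Ioi ht (div_pos hm ha).le).mul_const (C / m)
  refine IntegrableOn.congr_fun h (fun s hs => ?_) measurableSet_Ioi
  have hs : 0 < s := hs
  rw [Real.rpowIntegrand₀₁_eq_pow_div ht hs.le (div_pos hm ha).le]
  have : s + m / a ≠ 0 := by positivity
  field_simp

theorem continuousOn_kernel (hv : 0 < v.re) : ContinuousOn
    (fun p : ℂ × ℝ => ((p.2 ^ (t - 1) : ℝ) : ℂ) * (p.1 / ((p.2 : ℂ) * v + p.1)))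
    ({z | 0 < z.re} ×ˢ Ioi 0) := by
  refine ContinuousOn.mul ?_ (ContinuousOn.div (by fun_prop) (by fun_prop) ?_)
  · refine Complex.continuous_ofReal.comp_continuousOn
      (ContinuousOn.rpow_const (by fun_prop) fun p hp => Or.inl (ne_of_gt hp.2))
  · exact fun p hp => smul_add_ne_zero hv hp.1 (le_of_lt hp.2)

theorem norm_kernel_le (hv : 0 < v.re) {z : ℂ} {m M s : ℝ} (hm : 0 < m) (hz : m ≤ z.re)
    (hM : ‖z‖ ≤ M) (hs : 0 < s) : ‖((s ^ (t - 1) : ℝ) : ℂ) * (z / ((s : ℂ) * v + z))‖ ≤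
      s ^ (t - 1) * (M / (s * v.re + m)) := by
  have h0 : 0 < s ^ (t - 1) := Real.rpow_pos_of_pos hs _
  rw [norm_mul, norm_div, Complex.norm_real, Real.norm_eq_abs, abs_of_pos h0]
  have := le_norm_smul_add (v := v) (s := s) hz
  have : 0 < s * v.re + m := by positivity
  have := (norm_nonneg z).trans hM
  gcongr

theorem integrableOn_kernel (ht : t ∈ Ioo (0 : ℝ) 1) (hv : 0 < v.re) {z : ℂ} (hz : 0 < z.re) :
    IntegrableOn (fun s : ℝ => ((s ^ (t - 1) : ℝ) : ℂ) * (z / ((s : ℂ) * v + z))) (Ioi 0) := by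
  refine Integrable.mono' (integrableOn_rpow_div ht hv hz ‖z‖) ?_ ?_
  · exact ((continuousOn_kernel (t := t) hv).comp (f := fun s : ℝ => (z, s)) (by fun_prop)
      fun s hs => ⟨hz, hs⟩).aestronglyMeasurable
      measurableSet_Ioi
  · filter_upwards [ae_restrict_mem measurableSet_Ioi] with s hs
    exact norm_kernel_le hv hz le_rfl le_rfl hs

theorem differentiableOn_integral_kernel (ht : t ∈ Ioo (0 : ℝ) 1) (hv : 0 < v.re) :
    DifferentiableOn ℂ (fun z : ℂ =>
      ∫ s in Ioi (0 : ℝ), ((s ^ (t - 1) : ℝ) : ℂ) * (z / ((s : ℂ) * v + z))) {z | 0 < z.re} := by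
  intro z₀ hz₀
  have hz₀ : 0 < z₀.re := hz₀
  -- On this neighbourhood `Re z` is bounded below, so one integrable function dominates the
  -- derivatives `s v / (s v + z)²` for all `z` at once.
  have hopen : IsOpen {z : ℂ | z₀.re / 2 < z.re} := isOpen_lt continuous_const Complex.continuous_re
  have hmem : {z : ℂ | z₀.re / 2 < z.re} ∈ 𝓝 z₀ := hopen.mem_nhds (by
    simp only [mem_ofPred_eq]; linarith)
  have hpos : ∀ z ∈ {z : ℂ | z₀.re / 2 < z.re}, 0 < z.re := fun z hz => by
    simp only [mem_ofPred_eq] at hz; linarith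
  have key := hasDerivAt_integral_of_dominated_loc_of_deriv_le (μ := volume.restrict (Ioi (0 : ℝ)))
    (F := fun z s => ((s ^ (t - 1) : ℝ) : ℂ) * (z / ((s : ℂ) * v + z)))
    (F' := fun z s => ((s ^ (t - 1) : ℝ) : ℂ) * (s * v / ((s : ℂ) * v + z) ^ 2))
    (bound := fun s => s ^ (t - 1) * ((‖v‖ / v.re) / (s * v.re + z₀.re / 2)))
    hmem ?_ (integrableOn_kernel ht hv hz₀) ?_ ?_ (integrableOn_rpow_div ht hv (by linarith) _) ?_
  · exact key.2.differentiableAt.differentiableWithinAt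
  · filter_upwards [hmem] with z hz using (integrableOn_kernel ht hv (hpos z hz)).1
  · refine ContinuousOn.aestronglyMeasurable (ContinuousOn.mul ?_ (ContinuousOn.div
      (by fun_prop) (by fun_prop) fun s hs => ?_)) measurableSet_Ioi
    · exact Complex.continuous_ofReal.comp_continuousOn
        (ContinuousOn.rpow_const (by fun_prop) fun s hs => Or.inl (ne_of_gt hs))
    · exact pow_ne_zero 2 (smul_add_ne_zero hv hz₀ (le_of_lt hs))
  · filter_upwards [ae_restrict_mem measurableSet_Ioi] with s hs z hz
    have hs : 0 < s := hs
    have h0 : 0 < s ^ (t - 1) := Real.rpow_pos_of_pos hs _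
    rw [norm_mul, norm_div, norm_mul, norm_pow, Complex.norm_real, Complex.norm_real,
      Real.norm_eq_abs, Real.norm_eq_abs, abs_of_pos h0, abs_of_pos hs]
    refine mul_le_mul_of_nonneg_left ?_ h0.le
    have hz' : z₀.re / 2 ≤ z.re := le_of_lt hz
    have h1 := le_norm_smul_add (v := v) (s := s) hz'
    have h2 : 0 < s * v.re + z₀.re / 2 := by positivity
    calc s * ‖v‖ / ‖(s : ℂ) * v + z‖ ^ 2 ≤ s * ‖v‖ / (s * v.re + z₀.re / 2) ^ 2 := by gcongr
      _ ≤ _ := by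
        rw [div_div, div_le_div_iff₀ (by positivity) (by positivity)]
        have h3 : 0 ≤ ‖v‖ * (z₀.re / 2) * (s * v.re + z₀.re / 2) := by positivity
        nlinarith
  · filter_upwards [ae_restrict_mem measurableSet_Ioi] with s hs z hz
    have hne := smul_add_ne_zero hv (hpos z hz) (le_of_lt hs)
    have h := ((hasDerivAt_id z).fun_div ((hasDerivAt_id z).const_add ((s : ℂ) * v)) hne).const_mul
      (((s ^ (t - 1) : ℝ) : ℂ))
    simpa using h

theorem ofReal_mul_cpow {x : ℝ} (hx : 0 < x) (hv : v ≠ 0) (a : ℂ) :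
    ((x : ℂ) * v) ^ a = (x : ℂ) ^ a * v ^ a := by
  have hx' : (x : ℂ) ≠ 0 := by exact_mod_cast hx.ne'
  rw [Complex.cpow_def_of_ne_zero (mul_ne_zero hx' hv), Complex.cpow_def_of_ne_zero hx',
    Complex.cpow_def_of_ne_zero hv, Complex.log_ofReal_mul hx hv, Complex.ofReal_log hx.le, add_mul,
    Complex.exp_add]

/-- Balakrishnan's integral representation of `z ^ t` on the right half-plane, along the ray
through `v`. -/
theorem cpow_eq_integral (ht : t ∈ Ioo (0 : ℝ) 1) (hv : 0 < v.re) {z : ℂ} (hz : 0 < z.re) :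
    z ^ (t : ℂ) = v ^ (t : ℂ) * (((∫ s in Ioi 0, Real.rpowIntegrand₀₁ t s 1)⁻¹ : ℝ) *
      ∫ s in Ioi (0 : ℝ), ((s ^ (t - 1) : ℝ) : ℂ) * (z / ((s : ℂ) * v + z))) := by
  have hopen : IsOpen {z : ℂ | 0 < z.re} := isOpen_lt continuous_const Complex.continuous_re
  have hv0 : v ≠ 0 := fun h => by simp [h] at hv
  refine AnalyticOnNhd.eqOn_of_preconnected_of_frequently_eq (U := {z : ℂ | 0 < z.re}) (z₀ := v)
    (f := fun z => z ^ (t : ℂ))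
    (g := fun z => v ^ (t : ℂ) * (((∫ s in Ioi 0, Real.rpowIntegrand₀₁ t s 1)⁻¹ : ℝ) *
      ∫ s in Ioi (0 : ℝ), ((s ^ (t - 1) : ℝ) : ℂ) * (z / ((s : ℂ) * v + z))))
    (DifferentiableOn.analyticOnNhd (fun z hz => ?_) hopen)
    (DifferentiableOn.analyticOnNhd
      (((differentiableOn_integral_kernel ht hv).const_mul _).const_mul _) hopen)
    (convex_halfSpace_re_gt 0).isPreconnected hv ?_ hz
  · exact (differentiableAt_id.cpow_const (Or.inl hz)).differentiableWithinAt
  -- Identity theorem: both sides are holomorphic and agree at the points `x v`, `x > 0`, which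
  -- accumulate at `v`; there `v` cancels from the integrand and the real formula for `x ^ t`
  -- remains.
  · have htend : Tendsto (fun x : ℝ => v * (x : ℂ)) (𝓝[≠] 1) (𝓝[≠] v) := by
      refine tendsto_nhdsWithin_iff.2 ⟨?_, ?_⟩
      · have : Continuous fun x : ℝ => v * (x : ℂ) := by fun_prop
        simpa using (this.tendsto 1).mono_left nhdsWithin_le_nhds
      · filter_upwards [self_mem_nhdsWithin] with x hx h
        exact hx (by simpa [hv0] using h)
    refine htend.frequently (Eventually.frequently ?_)
    filter_upwards [nhdsWithin_le_nhds (Ioi_mem_nhds (zero_lt_one' ℝ))] with x hx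
    have hx : 0 < x := hx
    have e1 : (∫ s in Ioi (0 : ℝ), ((s ^ (t - 1) : ℝ) : ℂ) *
        (v * (x : ℂ) / ((s : ℂ) * v + v * (x : ℂ)))) =
        ((∫ s in Ioi 0, Real.rpowIntegrand₀₁ t s x : ℝ) : ℂ) := by
      rw [← integral_complex_ofReal]
      refine setIntegral_congr_fun measurableSet_Ioi fun s hs => ?_
      have hs : 0 < s := hs
      have hne : (s : ℂ) + x ≠ 0 := by norm_cast; positivity
      rw [Real.rpowIntegrand₀₁_eq_pow_div ht hs.le hx.le]
      push_cast
      rw [mul_comm (s : ℂ) v, ← mul_add, mul_div_mul_left _ _ hv0, mul_div_assoc]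
    rw [e1, ← Complex.ofReal_mul, ← Real.rpow_eq_const_mul_integral ht hx.le,
      mul_comm v, ofReal_mul_cpow hx hv0,
      Complex.ofReal_cpow hx.le, mul_comm]

/-- Fubini on the product of the angle interval and the half-line, with dominating function `r * g
s`. -/
theorem circleIntegral_integral_swap {c : ℂ} {r : ℝ} (hr : 0 ≤ r) {F : ℂ → ℝ → ℂ} {g : ℝ → ℝ}
    (hF : ContinuousOn (fun p : ℂ × ℝ => F p.1 p.2) (sphere c r ×ˢ Ioi 0))
    (hg : IntegrableOn g (Ioi 0)) (hFg : ∀ z ∈ sphere c r, ∀ s ∈ Ioi (0 : ℝ), ‖F z s‖ ≤ g s) :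
    IntegrableOn (fun s => ∮ z in C(c, r), F z s) (Ioi 0) ∧
      (∮ z in C(c, r), ∫ s in Ioi (0 : ℝ), F z s) =
        ∫ s in Ioi (0 : ℝ), ∮ z in C(c, r), F z s := by
  set G : ℝ → ℝ → ℂ := fun θ s => deriv (circleMap c r) θ • F (circleMap c r θ) s with hG
  have hGi : Integrable (Function.uncurry G)
      ((volume.restrict (Ioc 0 (2 * Real.pi))).prod (volume.restrict (Ioi 0))) := by
    have hbi : Integrable (fun p : ℝ × ℝ => r * g p.2)
        ((volume.restrict (Ioc 0 (2 * Real.pi))).prod (volume.restrict (Ioi 0))) :=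
      (hg.comp_snd _).const_mul r
    refine hbi.mono' ?_ ?_
    · rw [Measure.prod_restrict]
      refine ContinuousOn.aestronglyMeasurable ?_ (measurableSet_Ioc.prod measurableSet_Ioi)
      refine ContinuousOn.smul (f := fun p : ℝ × ℝ => deriv (circleMap c r) p.1)
        (g := fun p : ℝ × ℝ => F (circleMap c r p.1) p.2) ?_ ?_
      · simp only [deriv_circleMap]
        exact (((continuous_circleMap 0 r).comp continuous_fst).mul
          continuous_const).continuousOn
      · exact hF.comp (g := fun p : ℂ × ℝ => F p.1 p.2)
          (f := fun p : ℝ × ℝ => (circleMap c r p.1, p.2))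
          (((continuous_circleMap c r).comp continuous_fst).prodMk continuous_snd).continuousOn
          fun p hp => ⟨circleMap_mem_sphere c hr p.1, hp.2⟩
    · rw [Measure.prod_restrict]
      filter_upwards [ae_restrict_mem (measurableSet_Ioc.prod measurableSet_Ioi)] with p hp
      simp only [Function.uncurry, hG, deriv_circleMap, norm_smul, norm_mul, norm_circleMap_zero,
        Complex.norm_I, mul_one, abs_of_nonneg hr]
      exact mul_le_mul_of_nonneg_left (hFg _ (circleMap_mem_sphere c hr p.1) _ hp.2) hr
  have e1 : ∀ s, (∮ z in C(c, r), F z s) = ∫ θ in Ioc 0 (2 * Real.pi), G θ s := fun s => by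
    rw [circleIntegral, intervalIntegral.integral_of_le Real.two_pi_pos.le]
  constructor
  · simp only [e1]
    exact hGi.integral_prod_right
  · simp only [e1]
    rw [circleIntegral, intervalIntegral.integral_of_le Real.two_pi_pos.le,
      ← integral_integral_swap hGi]
    simp only [hG, integral_smul]

end Balakrishnan

/-! ### Fractional powers of sectorial matrices and their numerical ranges. -/

section FractionalPower

open Set Filter Topology MeasureTheory Metric Matrix

variable {n : ℕ} {A : Matrix (Fin n) (Fin n) ℂ} {c : ℂ} {r t : ℝ} {v : ℂ}

theorem inner_toEuclideanLin (M : Matrix (Fin n) (Fin n) ℂ) (x : EuclideanSpace ℂ (Fin n)) :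
    inner ℂ x (toEuclideanLin M x) = ∑ i, ∑ j, starRingEnd ℂ (x i) * (M i j * x j) := by
  simp [PiLp.inner_apply, toLpLin_apply, mulVec, dotProduct, Finset.mul_sum, mul_comm]

theorem toEuclideanLin_mul_apply (M N : Matrix (Fin n) (Fin n) ℂ) (x : EuclideanSpace ℂ (Fin n)) :
    toEuclideanLin (M * N) x = toEuclideanLin M (toEuclideanLin N x) := by
  rw [toLpLin_mul_same]; rfl

/-- Multiplicativity of the calculus identifies the integral of `(s v + z)⁻¹` with the inverse of `s
v + A`. -/
theorem add_mul_dunford_inv (hr : 0 < r) (hA : spectrum ℂ A ⊆ ball c r)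
    (hc : closedBall c r ⊆ {z | 0 < z.re}) (hv : 0 < v.re) {s : ℝ} (hs : 0 ≤ s) :
    (((s : ℂ) * v) • (1 : Matrix (Fin n) (Fin n) ℂ) + A) *
      dunford A (fun z => ((s : ℂ) * v + z)⁻¹) c r = 1 := by
  have hopen : IsOpen {z : ℂ | 0 < z.re} := isOpen_lt continuous_const Complex.continuous_re
  have h1 : dunford A (fun z => (s : ℂ) * v + z) c r = ((s : ℂ) * v) • 1 + A := by
    have := dunford_const_mul (A := A) (f := fun _ => 1) (c := c) (r := r) ((s : ℂ) * v)
    rw [dunford_one hr hA] at this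
    simp only [mul_one] at this
    rw [dunford_add hr hA continuousOn_const (continuousOn_id' _), this, dunford_id hr hA]
  rw [← h1, ← dunford_mul hr hA (by fun_prop)
    (DifferentiableOn.fun_inv (by fun_prop) fun z hz => smul_add_ne_zero hv hz hs) hopen hc,
    ← dunford_one hr hA]
  exact dunford_congr hr fun z hz =>
    mul_inv_cancel₀ (smul_add_ne_zero hv (hc (sphere_subset_closedBall hz)) hs)

theorem dunford_kernel (hr : 0 < r) (hA : spectrum ℂ A ⊆ ball c r)
    (hc : closedBall c r ⊆ {z | 0 < z.re}) (hv : 0 < v.re) {s : ℝ} (hs : 0 ≤ s) :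
    dunford A (fun z => ((s ^ (t - 1) : ℝ) : ℂ) * (z / ((s : ℂ) * v + z))) c r =
      ((s ^ (t - 1) : ℝ) : ℂ) • (A * dunford A (fun z => ((s : ℂ) * v + z)⁻¹) c r) := by
  have hopen : IsOpen {z : ℂ | 0 < z.re} := isOpen_lt continuous_const Complex.continuous_re
  rw [dunford_const_mul, ← dunford_id_mul hr hA
    (DifferentiableOn.fun_inv (by fun_prop) fun z hz => smul_add_ne_zero hv hz hs) hopen hc]
  simp only [div_eq_mul_inv]

/-- Balakrishnan's formula for the fractional power of a matrix. -/
theorem dunford_cpow_entry (hr : 0 < r) (hA : spectrum ℂ A ⊆ ball c r)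
    (hc : closedBall c r ⊆ {z | 0 < z.re}) (hv : 0 < v.re) (ht : t ∈ Ioo (0 : ℝ) 1)
    (i j : Fin n) :
    IntegrableOn (fun s : ℝ => ((s ^ (t - 1) : ℝ) : ℂ) *
        (A * dunford A (fun z => ((s : ℂ) * v + z)⁻¹) c r) i j) (Ioi 0) ∧
      dunford A (fun z => z ^ (t : ℂ)) c r i j = v ^ (t : ℂ) *
        (((∫ s in Ioi 0, Real.rpowIntegrand₀₁ t s 1)⁻¹ : ℝ) *
          ∫ s in Ioi (0 : ℝ), ((s ^ (t - 1) : ℝ) : ℂ) *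
            (A * dunford A (fun z => ((s : ℂ) * v + z)⁻¹) c r) i j) := by
  have hsub : sphere c r ⊆ {z | 0 < z.re} := sphere_subset_closedBall.trans hc
  -- Compactness keeps the circle at a positive distance from the imaginary axis, which makes the
  -- domination uniform in `z`.
  obtain ⟨m, hm, hmle⟩ : ∃ m : ℝ, 0 < m ∧ ∀ z ∈ sphere c r, m ≤ z.re := by
    obtain ⟨z, hz, hmin⟩ := (isCompact_sphere c r).exists_isMinOn
      (NormedSpace.sphere_nonempty.2 hr.le) Complex.continuous_re.continuousOn
    exact ⟨z.re, hsub hz, fun w hw => hmin hw⟩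
  obtain ⟨M, hM⟩ := (isCompact_sphere c r).isBounded.exists_norm_le
  have hρ := continuousOn_resolvent_entry hA i j
  obtain ⟨D, hD⟩ := (isCompact_sphere c r).exists_bound_of_continuousOn hρ
  set ρ : ℂ → ℂ := fun z => (z • (1 : Matrix (Fin n) (Fin n) ℂ) - A)⁻¹ i j with hρd
  have hswap := circleIntegral_integral_swap (c := c) hr.le
    (F := fun z s => ((s ^ (t - 1) : ℝ) : ℂ) * (z / ((s : ℂ) * v + z)) * ρ z)
    (g := fun s => s ^ (t - 1) * (M / (s * v.re + m)) * D)
    (((continuousOn_kernel hv).mono (prod_mono hsub subset_rfl)).mul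
      (hρ.comp continuousOn_fst fun p hp => hp.1))
    ((integrableOn_rpow_div ht hv hm M).mul_const D) fun z hz s hs => by
      rw [norm_mul]
      have h := norm_kernel_le (t := t) hv hm (hmle z hz) (hM z hz) hs
      exact mul_le_mul h (hD z hz) (norm_nonneg _) ((norm_nonneg _).trans h)
  have hk : ∀ s ∈ Ioi (0 : ℝ), ((s ^ (t - 1) : ℝ) : ℂ) *
      (A * dunford A (fun z => ((s : ℂ) * v + z)⁻¹) c r) i j =
      (2 * (Real.pi : ℂ) * Complex.I)⁻¹ *
        ∮ z in C(c, r), ((s ^ (t - 1) : ℝ) : ℂ) * (z / ((s : ℂ) * v + z)) * ρ z := fun s hs => by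
    have := congrFun (congrFun (dunford_kernel (t := t) hr hA hc hv (le_of_lt hs)) i) j
    rw [Matrix.smul_apply, smul_eq_mul] at this
    rw [← this, dunford_apply]
  constructor
  · exact IntegrableOn.congr_fun (hswap.1.const_mul (2 * (Real.pi : ℂ) * Complex.I)⁻¹)
      (fun s hs => (hk s hs).symm) measurableSet_Ioi
  · rw [setIntegral_congr_fun measurableSet_Ioi hk, integral_const_mul, ← hswap.2,
      dunford_congr hr fun z hz => cpow_eq_integral ht hv (hsub hz), dunford_const_mul,
      dunford_const_mul, Matrix.smul_apply, Matrix.smul_apply, dunford_apply, smul_eq_mul,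
      smul_eq_mul]
    simp only [integral_mul_const, hρd]

/-- Here `I` is a positive multiple of `∫ s^(t-1) ⟨x, A (s v + A)⁻¹ x⟩ ds`. With `y = (s v + A)⁻¹ x`
one has `x = s v y + A y`, so `⟨x, A y⟩ = s v̄ ⟨y, A y⟩ + ‖A y‖²`, and after multiplication by `β`
both terms have nonnegative real part. Thus a half-plane condition on `v̄ W(A)` passes to `v^(-t)
W(A^t)`. -/
theorem exists_inner_dunford_cpow (hr : 0 < r) (hA : spectrum ℂ A ⊆ ball c r)
    (hc : closedBall c r ⊆ {z | 0 < z.re}) (hv : 0 < v.re) (ht : t ∈ Ioo (0 : ℝ) 1) {β : ℂ}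
    (hβ : 0 ≤ β.re) (hq : ∀ y : EuclideanSpace ℂ (Fin n),
      0 ≤ (β * (starRingEnd ℂ v * inner ℂ y (toEuclideanLin A y))).re)
    (x : EuclideanSpace ℂ (Fin n)) :
    ∃ I : ℂ, 0 ≤ (β * I).re ∧
      inner ℂ x (toEuclideanLin (dunford A (fun z => z ^ (t : ℂ)) c r) x) = v ^ (t : ℂ) * I := by
  set K : ℝ := (∫ s in Ioi 0, Real.rpowIntegrand₀₁ t s 1)⁻¹
  have hK : 0 ≤ K := inv_nonneg.2 (Real.integral_rpowIntegrand₀₁_one_pos ht).le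
  set G : ℝ → Matrix (Fin n) (Fin n) ℂ := fun s => dunford A (fun z => ((s : ℂ) * v + z)⁻¹) c r
    with hG
  have hentry : ∀ i j, _ := fun i j => dunford_cpow_entry hr hA hc hv ht i j
  have hint : ∀ i j, IntegrableOn (fun s : ℝ => starRingEnd ℂ (x i) *
      (((s ^ (t - 1) : ℝ) : ℂ) * (A * G s) i j * x j)) (Ioi 0) := fun i j =>
    (((hentry i j).1).mul_const _).const_mul _
  have hform : ∀ s : ℝ, ((s ^ (t - 1) : ℝ) : ℂ) * inner ℂ x (toEuclideanLin (A * G s) x) =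
      ∑ i, ∑ j, starRingEnd ℂ (x i) * (((s ^ (t - 1) : ℝ) : ℂ) * (A * G s) i j * x j) := fun s => by
    simp only [inner_toEuclideanLin, Finset.mul_sum]
    refine Finset.sum_congr rfl fun i _ => Finset.sum_congr rfl fun j _ => ?_
    ring
  have hint' : IntegrableOn (fun s : ℝ => ((s ^ (t - 1) : ℝ) : ℂ) *
      inner ℂ x (toEuclideanLin (A * G s) x)) (Ioi 0) := by
    simp only [hform]
    exact integrable_finsetSum _ fun i _ => integrable_finsetSum _ fun j _ => hint i j
  refine ⟨K * ∫ s in Ioi (0 : ℝ), ((s ^ (t - 1) : ℝ) : ℂ) *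
    inner ℂ x (toEuclideanLin (A * G s) x), ?_, ?_⟩
  · rw [mul_left_comm, Complex.re_ofReal_mul, ← integral_const_mul]
    refine mul_nonneg hK ?_
    have h := Complex.reCLM.integral_comp_comm (hint'.const_mul β)
    simp only [Complex.reCLM_apply] at h
    rw [← h]
    refine setIntegral_nonneg measurableSet_Ioi fun s hs => ?_
    have hs : 0 < s := hs
    rw [mul_left_comm, Complex.re_ofReal_mul]
    refine mul_nonneg (Real.rpow_nonneg hs.le _) ?_
    set y := toEuclideanLin (G s) x with hy
    have hx : x = ((s : ℂ) * v) • y + toEuclideanLin A y := by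
      have := congrArg (fun M => toEuclideanLin M x) (add_mul_dunford_inv hr hA hc hv hs.le)
      simp only [toEuclideanLin_mul_apply, map_add, map_smul, toLpLin_one, LinearMap.add_apply,
        LinearMap.smul_apply, LinearMap.id_apply] at this
      exact this.symm
    rw [toEuclideanLin_mul_apply, ← hy]
    have e : β * inner ℂ x (toEuclideanLin A y) =
        (s : ℂ) * (β * (starRingEnd ℂ v * inner ℂ y (toEuclideanLin A y))) +
          ((‖toEuclideanLin A y‖ ^ 2 : ℝ) : ℂ) * β := by
      conv_lhs => rw [hx]
      rw [inner_add_left, inner_smul_left, inner_self_eq_norm_sq_to_K, map_mul, Complex.conj_ofReal]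
      push_cast
      simp only [Complex.coe_algebraMap]
      ring
    rw [e, Complex.add_re, Complex.re_ofReal_mul, Complex.re_ofReal_mul]
    exact add_nonneg (mul_nonneg hs.le (hq y)) (mul_nonneg (sq_nonneg _) hβ)
  · simp only [hform]
    rw [integral_finsetSum _ fun i _ => integrable_finsetSum _ fun j _ => hint i j,
      inner_toEuclideanLin, Finset.mul_sum, Finset.mul_sum]
    refine Finset.sum_congr rfl fun i _ => ?_
    rw [integral_finsetSum _ fun j _ => hint i j, Finset.mul_sum, Finset.mul_sum]
    refine Finset.sum_congr rfl fun j _ => ?_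
    rw [(hentry i j).2, integral_const_mul, integral_mul_const]
    ring

/-- Sectorial matrices have admissible circles in the open right half-plane. -/
theorem exists_circle_re_pos {γ : ℝ} (hA : A ∈ sectorialClass n γ) :
    ∃ (c : ℂ) (r : ℝ), 0 < r ∧ closedBall c r ⊆ {z | 0 < z.re} ∧ spectrum ℂ A ⊆ ball c r := by
  have hfin : (spectrum ℂ A).Finite := Matrix.finite_spectrum A
  obtain ⟨m, hm, hmle⟩ : ∃ m : ℝ, 0 < m ∧ ∀ l ∈ spectrum ℂ A, m ≤ l.re := by
    rcases (spectrum ℂ A).eq_empty_or_nonempty with h | h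
    · exact ⟨1, one_pos, by simp [h]⟩
    · obtain ⟨l, hl, hmin⟩ := Set.exists_min_image _ Complex.re hfin h
      exact ⟨l.re, spectrum_re_pos hA hl, hmin⟩
  obtain ⟨M, hM⟩ := hfin.isBounded.exists_norm_le
  -- The disc of centre `R` and radius `R - m/2` stays in `Re z ≥ m/2`. It contains each eigenvalue
  -- `l` because `|l - R|² ≤ M² - 2Rm + R²`, which is below `(R - m/2)²` once `M² < R m`.
  obtain ⟨R, hR1, hR2⟩ : ∃ R : ℝ, m < R ∧ M ^ 2 < R * m :=
    ⟨max m (M ^ 2 / m) + 1, by linarith [le_max_left m (M ^ 2 / m)], by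
      rw [← div_lt_iff₀ hm]; linarith [le_max_right m (M ^ 2 / m)]⟩
  refine ⟨R, R - m / 2, by linarith, fun z hz => ?_, fun l hl => ?_⟩
  · rw [mem_closedBall, dist_eq_norm] at hz
    have h1 := (Complex.abs_re_le_norm (z - R)).trans hz
    rw [Complex.sub_re, Complex.ofReal_re, abs_le] at h1
    simp only [mem_ofPred_eq]
    linarith
  · rw [mem_ball, dist_eq_norm]
    refine lt_of_pow_lt_pow_left₀ 2 (by linarith) ?_
    have h1 : ‖l‖ ^ 2 ≤ M ^ 2 := pow_le_pow_left₀ (norm_nonneg _) (hM l hl) 2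
    have h2 := hmle l hl
    rw [Complex.sq_norm, Complex.normSq_apply] at h1 ⊢
    simp only [Complex.sub_re, Complex.sub_im, Complex.ofReal_re, Complex.ofReal_im, sub_zero]
    nlinarith

theorem differentiableOn_cpow (t : ℝ) :
    DifferentiableOn ℂ (fun z : ℂ => z ^ (t : ℂ)) Complex.slitPlane := fun _ hz =>
  (differentiableAt_id.cpow_const hz).differentiableWithinAt

theorem re_pos_subset_slitPlane : {z : ℂ | 0 < z.re} ⊆ Complex.slitPlane := fun _ hz => Or.inl hz

/-- The fractional power is the Dunford integral over any admissible circle. -/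
theorem fracPow_eq_dunford (hr : 0 < r) (hc : closedBall c r ⊆ Complex.slitPlane)
    (hA : spectrum ℂ A ⊆ ball c r) (t : ℝ) :
    fracPow A t = dunford A (fun z => z ^ (t : ℂ)) c r := by
  have h : ∃ p : ℂ × ℝ, IsContour A p.1 p.2 := ⟨(c, r), hr, hc, hA⟩
  rw [fracPow, dif_pos h]
  exact dunford_eq_dunford h.choose_spec.1 h.choose_spec.2.2 hr hA (differentiableOn_cpow t)
    Complex.isOpen_slitPlane h.choose_spec.2.1 hc

theorem fracPow_mul_fracPow {γ : ℝ} (hA : A ∈ sectorialClass n γ) (α : ℝ) :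
    fracPow A α * fracPow A (1 - α) = A := by
  obtain ⟨c, r, hr, hc, hs⟩ := exists_circle_re_pos hA
  have hc' := hc.trans re_pos_subset_slitPlane
  rw [fracPow_eq_dunford hr hc' hs, fracPow_eq_dunford hr hc' hs, ← dunford_mul hr hs
    (differentiableOn_cpow _) (differentiableOn_cpow _) Complex.isOpen_slitPlane hc']
  conv_rhs => rw [← dunford_id hr hs]
  refine dunford_congr hr fun z hz => ?_
  have hz0 : z ≠ 0 := Complex.slitPlane_ne_zero (hc' (sphere_subset_closedBall hz))
  rw [← Complex.cpow_add _ _ hz0]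
  push_cast
  rw [add_sub_cancel, Complex.cpow_one]

theorem inner_mem_sector {γ : ℝ} (hA : A ∈ sectorialClass n γ) {x : EuclideanSpace ℂ (Fin n)}
    (hx : x ≠ 0) : inner ℂ x (toEuclideanLin A x) ∈ sector γ := by
  have hx0 : 0 < ‖x‖ := norm_pos_iff.2 hx
  have hmem : inner ℂ (((‖x‖⁻¹ : ℝ) : ℂ) • x) (toEuclideanLin A (((‖x‖⁻¹ : ℝ) : ℂ) • x)) ∈
      sector γ := hA ⟨_, by
    rw [norm_smul, Complex.norm_real, norm_inv, norm_norm, inv_mul_cancel₀ hx0.ne'], rfl⟩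
  rw [map_smul, inner_smul_left, inner_smul_right, Complex.conj_ofReal, ← mul_assoc,
    ← Complex.ofReal_mul] at hmem
  have hp : 0 < ‖x‖⁻¹ * ‖x‖⁻¹ := by positivity
  obtain ⟨h1, h2⟩ := hmem
  rw [Complex.re_ofReal_mul] at h1 h2
  rw [Complex.im_ofReal_mul, abs_mul, abs_of_pos hp, mul_left_comm] at h2
  exact ⟨pos_of_mul_pos_right h1 hp.le, le_of_mul_le_mul_left h2 hp⟩

/-- The sector condition cleared of its denominator; with weak inequalities it also covers `x = 0`.
-/
theorem abs_im_mul_cos_le {γ : ℝ} (hγ0 : 0 ≤ γ) (hγ1 : γ < Real.pi / 2)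
    (hA : A ∈ sectorialClass n γ) (x : EuclideanSpace ℂ (Fin n)) :
    0 ≤ (inner ℂ x (toEuclideanLin A x)).re ∧
      |(inner ℂ x (toEuclideanLin A x)).im| * Real.cos γ ≤
        Real.sin γ * (inner ℂ x (toEuclideanLin A x)).re := by
  rcases eq_or_ne x 0 with rfl | hx
  · simp
  obtain ⟨h1, h2⟩ := inner_mem_sector hA hx
  have hcos : 0 < Real.cos γ := Real.cos_pos_of_mem_Ioo ⟨by linarith [Real.pi_pos], hγ1⟩
  refine ⟨h1.le, ?_⟩
  rw [Real.tan_eq_sin_div_cos, div_mul_eq_mul_div, le_div_iff₀ hcos] at h2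
  exact h2

/-- Fractional powers of a matrix in `Π_γ` have numerical range in the sector of half-angle
`t γ`. -/
theorem fracPow_sectorial {γ : ℝ} (hγ0 : 0 ≤ γ) (hγ1 : γ < Real.pi / 2)
    (hA : A ∈ sectorialClass n γ) (ht : t ∈ Ioo (0 : ℝ) 1) (x : EuclideanSpace ℂ (Fin n)) :
    0 ≤ (inner ℂ x (toEuclideanLin (fracPow A t) x)).re ∧
      |(inner ℂ x (toEuclideanLin (fracPow A t) x)).im| * Real.cos (t * γ) ≤
        Real.sin (t * γ) * (inner ℂ x (toEuclideanLin (fracPow A t) x)).re := by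
  obtain ⟨c, r, hr, hc, hs⟩ := exists_circle_re_pos hA
  rw [fracPow_eq_dunford hr (hc.trans re_pos_subset_slitPlane) hs]
  have hcos : 0 < Real.cos γ := Real.cos_pos_of_mem_Ioo ⟨by linarith [Real.pi_pos], hγ1⟩
  set q := inner ℂ x (toEuclideanLin (dunford A (fun z => z ^ (t : ℂ)) c r) x) with hq
  -- The restriction on `φ` keeps the logarithm on the principal branch.
  have hpow : ∀ φ : ℝ, |φ| < Real.pi / 2 →
      Complex.exp (φ * Complex.I) ^ (t : ℂ) = Complex.exp ((t * φ : ℝ) * Complex.I) := fun φ hφ => by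
    rw [abs_lt] at hφ
    rw [Complex.cpow_def_of_ne_zero (Complex.exp_ne_zero _), Complex.log_exp]
    · push_cast; congr 1; ring
    · simp; linarith [Real.pi_pos]
    · simp; linarith [Real.pi_pos]
  have hrot : ∀ (φ : ℝ) (I : ℂ), q = Complex.exp (φ * Complex.I) * I →
      I = Complex.exp ((-φ : ℝ) * Complex.I) * q := fun φ I h => by
    rw [h, ← mul_assoc, ← Complex.exp_add]
    push_cast
    rw [neg_mul, neg_add_cancel, Complex.exp_zero, one_mul]
  have hre : 0 ≤ q.re := by
    obtain ⟨I, hI, h⟩ := exists_inner_dunford_cpow (v := 1) (β := 1) hr hs hc (by simp) ht (by simp)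
      (fun y => by simpa using (abs_im_mul_cos_le hγ0 hγ1 hA y).1) x
    rw [← hq] at h
    rw [h]
    simpa using hI
  -- For `v = e^(iγ)` and `β = i` the hypothesis says that `e^(-iγ)⟨y, Ay⟩` has nonpositive
  -- imaginary part, and the conclusion says the same of `e^(-itγ) q`: the upper edge of the sector
  -- of angle `tγ`.
  have hup : q.im * Real.cos (t * γ) ≤ Real.sin (t * γ) * q.re := by
    obtain ⟨I, hI, h⟩ := exists_inner_dunford_cpow (v := Complex.exp (γ * Complex.I))
      (β := Complex.I) hr hs hc (by rw [Complex.exp_ofReal_mul_I_re]; exact hcos) ht (by simp)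
      (fun y => by
        have h1 := (abs_im_mul_cos_le hγ0 hγ1 hA y).2
        have h2 := mul_le_mul_of_nonneg_right
          (le_abs_self (inner ℂ y (toEuclideanLin A y)).im) hcos.le
        simp only [Complex.mul_re, Complex.I_re, Complex.I_im, Complex.mul_im, Complex.conj_re,
          Complex.conj_im, Complex.exp_ofReal_mul_I_re, Complex.exp_ofReal_mul_I_im]
        linarith) x
    rw [← hq, hpow γ (by rwa [abs_of_nonneg hγ0])] at h
    rw [hrot _ _ h] at hI
    simp only [Complex.mul_re, Complex.I_re, Complex.I_im, Complex.mul_im,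
      Complex.exp_ofReal_mul_I_re, Complex.exp_ofReal_mul_I_im, Real.cos_neg, Real.sin_neg] at hI
    linarith
  -- The lower edge, by the conjugate choice `v = e^(-iγ)`, `β = -i`.
  have hlo : -q.im * Real.cos (t * γ) ≤ Real.sin (t * γ) * q.re := by
    obtain ⟨I, hI, h⟩ := exists_inner_dunford_cpow (v := Complex.exp ((-γ : ℝ) * Complex.I))
      (β := -Complex.I) hr hs hc
      (by rw [Complex.exp_ofReal_mul_I_re, Real.cos_neg]; exact hcos) ht (by simp)
      (fun y => by
        have h1 := (abs_im_mul_cos_le hγ0 hγ1 hA y).2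
        have h2 := mul_le_mul_of_nonneg_right
          (neg_le_abs (inner ℂ y (toEuclideanLin A y)).im) hcos.le
        simp only [Complex.mul_re, Complex.neg_re, Complex.neg_im, Complex.I_re, Complex.I_im,
          Complex.mul_im, Complex.conj_re, Complex.conj_im, Complex.exp_ofReal_mul_I_re,
          Complex.exp_ofReal_mul_I_im, Real.cos_neg, Real.sin_neg]
        linarith) x
    rw [← hq, hpow (-γ) (by rwa [abs_neg, abs_of_nonneg hγ0])] at h
    rw [hrot _ _ h] at hI
    simp only [Complex.mul_re, Complex.neg_re, Complex.neg_im, Complex.I_re, Complex.I_im,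
      Complex.mul_im, Complex.exp_ofReal_mul_I_re, Complex.exp_ofReal_mul_I_im, mul_neg,
      neg_neg] at hI
    linarith
  refine ⟨hre, ?_⟩
  rcases abs_cases q.im with ⟨h, _⟩ | ⟨h, _⟩ <;> rw [h] <;> assumption

end FractionalPower

/-! ### Numerical radius estimates and the final product bounds. -/

section NumericalRadius

open Matrix

variable {n : ℕ} {A B : Matrix (Fin n) (Fin n) ℂ}

theorem numericalRadius_nonneg (A : Matrix (Fin n) (Fin n) ℂ) : 0 ≤ numericalRadius A :=
  Real.sSup_nonneg (by rintro _ ⟨w, _, rfl⟩; exact norm_nonneg w)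

theorem norm_inner_le_numericalRadius (A : Matrix (Fin n) (Fin n) ℂ)
    (x : EuclideanSpace ℂ (Fin n)) :
    ‖inner ℂ x (toEuclideanLin A x)‖ ≤ numericalRadius A * ‖x‖ ^ 2 := by
  rcases eq_or_ne x 0 with rfl | hx
  · simp
  have hx0 : 0 < ‖x‖ := norm_pos_iff.2 hx
  have hbdd : BddAbove ((fun w : ℂ => ‖w‖) '' numericalRange A) := by
    refine ⟨‖(toEuclideanLin A).toContinuousLinearMap‖, ?_⟩
    rintro _ ⟨_, ⟨y, hy, rfl⟩, rfl⟩
    refine (norm_inner_le_norm _ _).trans ?_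
    rw [hy, one_mul]
    simpa [hy] using (toEuclideanLin A).toContinuousLinearMap.le_opNorm y
  have h := le_csSup hbdd ⟨_, ⟨((‖x‖⁻¹ : ℝ) : ℂ) • x, by
    rw [norm_smul, Complex.norm_real, norm_inv, norm_norm, inv_mul_cancel₀ hx0.ne'], rfl⟩, rfl⟩
  simp only [map_smul, inner_smul_left, inner_smul_right, norm_mul, Complex.conj_ofReal,
    Complex.norm_real, norm_inv, norm_norm] at h
  have e : ‖inner ℂ x (toEuclideanLin A x)‖ =
      ‖x‖⁻¹ * (‖x‖⁻¹ * ‖inner ℂ x (toEuclideanLin A x)‖) * ‖x‖ ^ 2 := by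
    field_simp
  rw [e]
  exact mul_le_mul_of_nonneg_right h (by positivity)

/-- Nonnegativity of `C` covers `n = 0`, where there are no unit vectors and the supremum of the
empty set is `0`. -/
theorem numericalRadius_le {C : ℝ} (hC : 0 ≤ C)
    (h : ∀ x : EuclideanSpace ℂ (Fin n), ‖x‖ = 1 → ‖inner ℂ x (toEuclideanLin A x)‖ ≤ C) :
    numericalRadius A ≤ C :=
  Real.sSup_le (by rintro _ ⟨_, ⟨x, hx, rfl⟩, rfl⟩; exact h x hx) hC

/-- `‖A ^ t‖ ≤ √(1 + 2 sin² (t γ)) w(A ^ t)` for `A` in `Π_γ`. -/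
theorem norm_fracPow_apply_le {γ t : ℝ} (hγ0 : 0 ≤ γ) (hγ1 : γ < Real.pi / 2)
    (hA : A ∈ sectorialClass n γ) (ht : t ∈ Set.Ioo (0 : ℝ) 1) (x : EuclideanSpace ℂ (Fin n)) :
    ‖toEuclideanLin (fracPow A t) x‖ ≤
      Real.sqrt (1 + 2 * Real.sin (t * γ) ^ 2) * numericalRadius (fracPow A t) * ‖x‖ := by
  have htγ0 : 0 ≤ t * γ := mul_nonneg ht.1.le hγ0
  have htγ1 : t * γ ≤ γ := mul_le_of_le_one_left hγ0 ht.2.le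
  have hsin : 0 ≤ Real.sin (t * γ) :=
    Real.sin_nonneg_of_nonneg_of_le_pi htγ0 (by linarith [Real.pi_pos])
  have hcos : 0 < Real.cos (t * γ) :=
    Real.cos_pos_of_mem_Ioo ⟨by linarith [Real.pi_pos], by linarith⟩
  refine norm_apply_le_of_sectorial hsin (fun y => (fracPow_sectorial hγ0 hγ1 hA ht y).1)
    (fun y => ?_) (norm_inner_le_numericalRadius _) (numericalRadius_nonneg _) x
  have h := (fracPow_sectorial hγ0 hγ1 hA ht y).2
  set q := inner ℂ y (toEuclideanLin (fracPow A t) y)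
  -- Squaring gives `(Im q)² cos² ≤ sin² (Re q)²`; adding `sin² (Im q)²` to both sides turns it into
  -- `(Im q)² ≤ sin² |q|²`.
  refine abs_le_of_sq_le_sq ?_ (by positivity)
  have h2 := pow_le_pow_left₀ (by positivity) h 2
  rw [mul_pow, mul_pow, sq_abs] at h2
  rw [mul_pow, Complex.sq_norm, Complex.normSq_apply]
  have h3 := Real.sin_sq_add_cos_sq (t * γ)
  linear_combination h2 - q.im ^ 2 * h3

/-- The common source of both inequalities: factor `A` and `B` through their powers `α` and `1 - α`,
and bound each factor by `norm_fracPow_apply_le`. -/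
theorem numericalRadius_add_le {γ α : ℝ} (hγ0 : 0 ≤ γ) (hγ1 : γ < Real.pi / 2)
    (hA : A ∈ sectorialClass n γ) (hB : B ∈ sectorialClass n γ) (hα : α ∈ Set.Ioo (0 : ℝ) 1) :
    numericalRadius (A + B) ≤ Real.sqrt (1 + 2 * Real.sin (α * γ) ^ 2) *
      Real.sqrt (1 + 2 * Real.sin ((1 - α) * γ) ^ 2) *
      (numericalRadius (fracPow A α) * numericalRadius (fracPow A (1 - α)) +
        numericalRadius (fracPow B α) * numericalRadius (fracPow B (1 - α))) := by
  have hα' : 1 - α ∈ Set.Ioo (0 : ℝ) 1 := ⟨by linarith [hα.2], by linarith [hα.1]⟩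
  have hprod : ∀ {C : Matrix (Fin n) (Fin n) ℂ}, C ∈ sectorialClass n γ →
      ∀ x : EuclideanSpace ℂ (Fin n), ‖x‖ = 1 → ‖toEuclideanLin C x‖ ≤
        Real.sqrt (1 + 2 * Real.sin (α * γ) ^ 2) * numericalRadius (fracPow C α) *
        (Real.sqrt (1 + 2 * Real.sin ((1 - α) * γ) ^ 2) *
          numericalRadius (fracPow C (1 - α))) := by
    intro C hC x hx
    have h1 := norm_fracPow_apply_le hγ0 hγ1 hC hα (toEuclideanLin (fracPow C (1 - α)) x)
    have h2 := norm_fracPow_apply_le hγ0 hγ1 hC hα' x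
    rw [← toEuclideanLin_mul_apply, fracPow_mul_fracPow hC] at h1
    rw [hx, mul_one] at h2
    exact h1.trans (mul_le_mul_of_nonneg_left h2
      (mul_nonneg (Real.sqrt_nonneg _) (numericalRadius_nonneg _)))
  have hn := fun M : Matrix (Fin n) (Fin n) ℂ => numericalRadius_nonneg M
  refine numericalRadius_le (mul_nonneg (by positivity) (add_nonneg
    (mul_nonneg (hn _) (hn _)) (mul_nonneg (hn _) (hn _)))) fun x hx => ?_
  refine (norm_inner_le_norm _ _).trans ?_
  rw [hx, one_mul, map_add, LinearMap.add_apply]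
  refine (norm_add_le _ _).trans ((add_le_add (hprod hA x hx) (hprod hB x hx)).trans_eq ?_)
  ring

/-- The excess over `p q (a a' + b b')` is `p q (a b' + b a')` in the first product and `p² a b + q²
a' b'` in the second. -/
theorem prod_bounds_of_le {w p q a a' b b' : ℝ} (hp : 0 ≤ p) (hq : 0 ≤ q) (ha : 0 ≤ a)
    (ha' : 0 ≤ a') (hb : 0 ≤ b) (hb' : 0 ≤ b') (h : w ≤ p * q * (a * a' + b * b')) :
    w ≤ p * q * (a + b) * (a' + b') ∧ w ≤ (p * a + q * b') * (q * a' + p * b) := by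
  constructor
  · have : 0 ≤ p * q * (a * b' + b * a') := by positivity
    linarith
  · have : 0 ≤ p ^ 2 * (a * b) + q ^ 2 * (a' * b') := by positivity
    linarith

end NumericalRadius

end SectorialMatrix

theorem corollary2p14 (n : ℕ) (γ : ℝ) (hγ0 : 0 ≤ γ) (hγ1 : γ < Real.pi / 2)
    (A B : Matrix (Fin n) (Fin n) ℂ)
    (hA : A ∈ SectorialMatrix.sectorialClass n γ) (hB : B ∈ SectorialMatrix.sectorialClass n γ)
    (α : ℝ) (hα0 : 0 < α) (hα1 : α < 1) :
    SectorialMatrix.numericalRadius (A + B) ≤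
        Real.sqrt (1 + 2 * Real.sin (α * γ) ^ 2) *
          Real.sqrt (1 + 2 * Real.sin ((1 - α) * γ) ^ 2) *
          (SectorialMatrix.numericalRadius (SectorialMatrix.fracPow A α) +
            SectorialMatrix.numericalRadius (SectorialMatrix.fracPow B α)) *
          (SectorialMatrix.numericalRadius (SectorialMatrix.fracPow A (1 - α)) +
            SectorialMatrix.numericalRadius (SectorialMatrix.fracPow B (1 - α))) ∧
      SectorialMatrix.numericalRadius (A + B) ≤
        (Real.sqrt (1 + 2 * Real.sin (α * γ) ^ 2) *
            SectorialMatrix.numericalRadius (SectorialMatrix.fracPow A α) +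
          Real.sqrt (1 + 2 * Real.sin ((1 - α) * γ) ^ 2) *
            SectorialMatrix.numericalRadius (SectorialMatrix.fracPow B (1 - α))) *
        (Real.sqrt (1 + 2 * Real.sin ((1 - α) * γ) ^ 2) *
            SectorialMatrix.numericalRadius (SectorialMatrix.fracPow A (1 - α)) +
          Real.sqrt (1 + 2 * Real.sin (α * γ) ^ 2) *
            SectorialMatrix.numericalRadius (SectorialMatrix.fracPow B α)) :=
  SectorialMatrix.prod_bounds_of_le (Real.sqrt_nonneg _) (Real.sqrt_nonneg _)
    (SectorialMatrix.numericalRadius_nonneg _) (SectorialMatrix.numericalRadius_nonneg _)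
    (SectorialMatrix.numericalRadius_nonneg _) (SectorialMatrix.numericalRadius_nonneg _)
    (SectorialMatrix.numericalRadius_add_le hγ0 hγ1 hA hB ⟨hα0, hα1⟩)
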